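/- Let $n\ge 1$ be an integer, $0<\beta<1$ and $1\le p<n/\beta$ (with $p$ real), put $\lambda=(n-p\beta)/p$, and for a unit vector $\eta\in S^{n-1}\subset\mathbb R^n$ let $$D_{p,\beta}=\int_{\mathbb R^n}\bigl|1-|x|^{-\lambda}\bigr|^p\,|x-\eta|^{-n-p\beta}\,dx .$$ Then for every (real- or complex-valued) Schwartz function $f\in\mathcal S(\mathbb R^n)$, $$\int_{\mathbb R^n\times\mathbb R^n}\frac{|f(x)-f(y)|^p}{|x-y|^{n+p\beta}}\,dx\,dy\ \ge\ D_{p,\beta}\int_{\mathbb R^n}|x|^{-p\beta}|f(x)|^p\,dx ,$$ and the constant $D_{p,\beta}$ is optimal: if $C\in[0,\infty]$ is such that the inequality holds with $C$ in place of $D_{p,\beta}$ for all $f\in\mathcal S(\mathbb R^n)$, then $C\le D_{p,\beta}$. -/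

import Mathlib

open MeasureTheory
open scoped ENNReal SchwartzMap

noncomputable section

/-- The integral of `|f(x) - f(y)|^p / |x - y|^(n + pβ)` over `ℝⁿ × ℝⁿ`, with value in `[0, ∞]`. -/
def besovEnergy {n : ℕ} {𝕜 : Type*} [RCLike 𝕜] (p β : ℝ)
    (f : EuclideanSpace ℝ (Fin n) → 𝕜) : ℝ≥0∞ :=
  ∫⁻ z : EuclideanSpace ℝ (Fin n) × EuclideanSpace ℝ (Fin n),
    ENNReal.ofReal (‖f z.1 - f z.2‖ ^ p / ‖z.1 - z.2‖ ^ ((n : ℝ) + p * β))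

/-- The integral of `|x|^(-pβ) |f(x)|^p` over `ℝⁿ`, with value in `[0, ∞]`. -/
def hardyIntegral {n : ℕ} {𝕜 : Type*} [RCLike 𝕜] (p β : ℝ)
    (f : EuclideanSpace ℝ (Fin n) → 𝕜) : ℝ≥0∞ :=
  ∫⁻ x : EuclideanSpace ℝ (Fin n), ENNReal.ofReal (‖x‖ ^ (-(p * β)) * ‖f x‖ ^ p)

/-- The constant `D_{p,β}`: the integral of `|1 - |x|^(-λ)|^p |x - η|^(-n-pβ)` over `ℝⁿ`,
where `λ = (n - pβ) / p`, with value in `[0, ∞]`. -/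
def hardyConst {n : ℕ} (p β : ℝ) (η : EuclideanSpace ℝ (Fin n)) : ℝ≥0∞ :=
  ∫⁻ x : EuclideanSpace ℝ (Fin n),
    ENNReal.ofReal
      (|1 - ‖x‖ ^ (-(((n : ℝ) - p * β) / p))| ^ p * ‖x - η‖ ^ (-(n : ℝ) - p * β))

end

/-! Write x = e^t ω and y = e^(t+τ) ω', with d the dimension, a = pβ and l = (d - a)/p. The energy
becomes an integral over τ, with weight e^(dτ), of ∫ |f(x) - f(y)|^p dμ_τ, where μ_τ is
`pairMeasure`. Let H be the Hardy integral of f and K(τ) the `sphereKernel`, which by rotation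
invariance is the same for all unit vectors. Under μ_τ the p-th powers of the L^p norms of f(x) and
f(y) are K(τ) H and e^(-plτ) K(τ) H. Minkowski's inequality therefore bounds the inner integral
below by |1 - e^(-lτ)|^p K(τ) H (`le_lintegral_pairMeasure`), and integrating over τ gives the
constant times H.

Equality would need f(y) = e^(-lτ) f(x), that is f = |x|^(-l), whose Hardy integral diverges.
Cutting this power off at |log|x|| of order N costs, for each τ, a relative L^p error that tends to
0 as N → ∞ (`lintegral_pairMeasure_cutoffPower_le`). The error is dominated by a multiple of |1 -
e^(-lτ)| (`exp_mul_min_le`), so dominated convergence in τ recovers the constant. -/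

/-! ### Polar coordinates and rotations of the sphere -/

open Metric Set in
/-- Polar coordinates with logarithmic radius. -/
theorem lintegral_eq_lintegral_sphere_exp {E : Type*} [NormedAddCommGroup E] [NormedSpace ℝ E]
    [MeasurableSpace E] [BorelSpace E] [FiniteDimensional ℝ E] [Nontrivial E]
    (μ : Measure E) [μ.IsAddHaarMeasure] {F : E → ℝ≥0∞} (hF : Measurable F) :
    ∫⁻ x, F x ∂μ = ∫⁻ ω, (∫⁻ t : ℝ, ENNReal.ofReal (Real.exp (Module.finrank ℝ E * t)) *
      F (Real.exp t • (ω : E))) ∂μ.toSphere := by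
  have h1 : ∫⁻ x, F x ∂μ = ∫⁻ x : ({0}ᶜ : Set E), F x ∂(μ.comap (↑)) := by
    rw [lintegral_subtype_comap (measurableSet_singleton _).compl, restrict_compl_singleton]
  have h2 : ∫⁻ x : ({0}ᶜ : Set E), F x ∂(μ.comap (↑)) =
      ∫⁻ z, F (z.2.1 • z.1.1) ∂(μ.toSphere.prod (.volumeIoiPow (Module.finrank ℝ E - 1))) := by
    rw [← μ.measurePreserving_homeomorphUnitSphereProd.lintegral_comp_emb
      (Homeomorph.measurableEmbedding _)]
    refine lintegral_congr fun x => ?_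
    have : ‖(x : E)‖ ≠ 0 := norm_ne_zero_iff.2 x.2
    simp [smul_smul, this]
  rw [h1, h2, lintegral_prod _ (by fun_prop)]
  refine lintegral_congr fun ω => ?_
  have hd : 0 < Module.finrank ℝ E := Module.finrank_pos
  rw [Measure.volumeIoiPow, lintegral_withDensity_eq_lintegral_mul _ (by fun_prop) (by fun_prop)]
  simp only [Pi.mul_apply]
  rw [lintegral_subtype_comap measurableSet_Ioi
    (fun r : ℝ => ENNReal.ofReal (r ^ (Module.finrank ℝ E - 1)) * F (r • (ω : E))),
    ← Real.range_exp, ← image_univ,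
    lintegral_image_eq_lintegral_abs_deriv_mul MeasurableSet.univ
      (fun x _ => (Real.hasDerivAt_exp x).hasDerivWithinAt) Real.exp_injective.injOn,
    setLIntegral_univ]
  refine lintegral_congr fun t => ?_
  -- The Jacobian e^t of r = e^t raises the radial density r^(d-1) to e^(dt); d > 0 makes d - 1 + 1
  -- = d.
  rw [← mul_assoc, ← ENNReal.ofReal_mul (abs_nonneg _), abs_of_pos (Real.exp_pos _), ← pow_succ',
    Nat.sub_add_cancel hd, Real.exp_nat_mul]

open Metric Set in
/-- The action of a linear isometry on the unit sphere. -/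
def LinearIsometryEquiv.sphereMap {E : Type*} [NormedAddCommGroup E] [NormedSpace ℝ E]
    (R : E ≃ₗᵢ[ℝ] E) (ω : sphere (0 : E) 1) : sphere (0 : E) 1 :=
  ⟨R ω, by simp⟩

-- The sphere measure of s is d times the volume of the cone (0,1)·s, and an isometry maps cones to
-- cones preserving volume.
open Metric Set Pointwise in
theorem LinearIsometryEquiv.measurePreserving_sphereMap {E : Type*} [NormedAddCommGroup E]
    [InnerProductSpace ℝ E] [MeasurableSpace E] [BorelSpace E] [FiniteDimensional ℝ E]
    (R : E ≃ₗᵢ[ℝ] E) :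
    MeasurePreserving R.sphereMap (volume : Measure E).toSphere (volume : Measure E).toSphere := by
  have hm : Measurable R.sphereMap :=
    (Continuous.subtype_mk (by fun_prop) _).measurable
  refine ⟨hm, Measure.ext fun s hs => ?_⟩
  rw [Measure.map_apply hm hs, Measure.toSphere_apply' _ hs, Measure.toSphere_apply' _ (hm hs)]
  congr 1
  symm
  rw [← R.measurePreserving.measure_preimage_emb R.toHomeomorph.measurableEmbedding]
  congr 1
  ext x
  simp only [mem_smul, mem_image, mem_preimage, Subtype.exists, exists_and_right, exists_eq_right]
  constructor
  · rintro ⟨r, hr, y, ⟨hy, hys⟩, hx⟩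
    refine ⟨r, hr, R.symm y, ⟨by simpa using hy, ?_⟩, R.injective (by simp [hx])⟩
    simpa [LinearIsometryEquiv.sphereMap] using hys
  · rintro ⟨r, hr, y, ⟨hy, hys⟩, hx⟩
    exact ⟨r, hr, R y, ⟨by simpa using hy, hys⟩, by simp [← hx]⟩

-- The reflection in the hyperplane orthogonal to u - v carries u to v.
open Metric Set in
theorem lintegral_toSphere_dist_eq {E : Type*} [NormedAddCommGroup E]
    [InnerProductSpace ℝ E] [MeasurableSpace E] [BorelSpace E] [FiniteDimensional ℝ E]
    {h : ℝ → ℝ≥0∞} (c : ℝ) (hh : Measurable h) (u v : E) (huv : ‖u‖ = ‖v‖) :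
    ∫⁻ ω, h ‖u - c • (ω : E)‖ ∂(volume : Measure E).toSphere =
      ∫⁻ ω, h ‖v - c • (ω : E)‖ ∂(volume : Measure E).toSphere := by
  set R : E ≃ₗᵢ[ℝ] E := (ℝ ∙ (u - v))ᗮ.reflection with hR
  have hRu : R u = v := Submodule.reflection_sub huv
  rw [← R.measurePreserving_sphereMap.lintegral_comp (f := fun ω => h ‖v - c • (ω : E)‖)
    (by fun_prop)]
  refine lintegral_congr fun ω => ?_
  rw [← hRu, LinearIsometryEquiv.sphereMap, ← map_smul, ← map_sub, R.norm_map]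

theorem norm_sub_smul_comm_of_norm_one {E : Type*} [NormedAddCommGroup E]
    [InnerProductSpace ℝ E] (c : ℝ) {u v : E} (hu : ‖u‖ = 1) (hv : ‖v‖ = 1) :
    ‖u - c • v‖ = ‖v - c • u‖ := by
  rw [← sq_eq_sq₀ (norm_nonneg _) (norm_nonneg _), @norm_sub_sq_real, @norm_sub_sq_real]
  simp [norm_smul, hu, hv, inner_smul_right, real_inner_comm]

/-! ### Disintegration along the ratio of the radii -/

section LogPolar

variable {E : Type*} [NormedAddCommGroup E] [InnerProductSpace ℝ E] [MeasurableSpace E]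
  [BorelSpace E] [FiniteDimensional ℝ E]

/-- The integral of `‖u - e^τ ω‖^(-s)` over the unit sphere. -/
noncomputable def sphereKernel (s τ : ℝ) (u : E) : ℝ≥0∞ :=
  ∫⁻ ω, ENNReal.ofReal (‖u - Real.exp τ • (ω : E)‖ ^ (-s)) ∂(volume : Measure E).toSphere

/-- The measure on pairs of points `(e^t ω, e^(t+τ) ω')`, in the coordinates `((ω, t), ω')`,
whose density is the kernel `‖x - y‖^(-d-a)` in polar coordinates, without the factor depending
only on `τ`. -/
noncomputable def pairMeasure (E : Type*) [NormedAddCommGroup E] [InnerProductSpace ℝ E]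
    [MeasurableSpace E] [BorelSpace E] [FiniteDimensional ℝ E] (a τ : ℝ) :
    Measure ((Metric.sphere (0 : E) 1 × ℝ) × Metric.sphere (0 : E) 1) :=
  (((volume : Measure E).toSphere.prod volume).prod (volume : Measure E).toSphere).withDensity
    fun z => ENNReal.ofReal (Real.exp ((Module.finrank ℝ E - a) * z.1.2)) *
      ENNReal.ofReal (‖(z.1.1 : E) - Real.exp τ • (z.2 : E)‖ ^ (-(Module.finrank ℝ E + a)))

theorem sphereKernel_eq_of_norm_eq (s τ : ℝ) {u v : E} (h : ‖u‖ = ‖v‖) :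
    sphereKernel s τ u = sphereKernel s τ v :=
  lintegral_toSphere_dist_eq (h := fun r => ENNReal.ofReal (r ^ (-s))) _ (by fun_prop) u v h

theorem sphereKernel_comm (s τ : ℝ) {u : E} (hu : ‖u‖ = 1) :
    ∫⁻ ω, ENNReal.ofReal (‖(ω : E) - Real.exp τ • u‖ ^ (-s)) ∂(volume : Measure E).toSphere =
      sphereKernel s τ u := by
  refine lintegral_congr fun ω => ?_
  rw [norm_sub_smul_comm_of_norm_one _ (by simp) hu]

theorem measurable_sphereKernel (s : ℝ) (u : E) : Measurable fun τ => sphereKernel s τ u :=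
  Measurable.lintegral_prod_right' (f := fun z : ℝ × Metric.sphere (0 : E) 1 =>
    ENNReal.ofReal (‖u - Real.exp z.1 • (z.2 : E)‖ ^ (-s))) (by fun_prop)

/-- The spheres of radii 1 and e^τ are at distance |1 - e^τ|; they coincide only for τ = 0. -/
theorem sphereKernel_lt_top {s τ : ℝ} (hs : 0 ≤ s) (hτ : τ ≠ 0) {u : E} (hu : ‖u‖ = 1) :
    sphereKernel s τ u < ∞ := by
  have hc : 0 < |1 - Real.exp τ| := by
    rw [abs_pos, sub_ne_zero]
    exact fun h => hτ (by simpa using h.symm)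
  refine lt_of_le_of_lt (lintegral_mono (g := fun _ => ENNReal.ofReal (|1 - Real.exp τ| ^ (-s)))
    fun ω => ENNReal.ofReal_le_ofReal (Real.rpow_le_rpow_of_nonpos hc ?_ (by linarith))) ?_
  · simpa [hu, norm_smul] using abs_norm_sub_norm_le u (Real.exp τ • (ω : E))
  · rw [lintegral_const]
    exact ENNReal.mul_lt_top ENNReal.ofReal_lt_top (measure_lt_top _ _)

variable [Nontrivial E]

/-- Polar coordinates for an integral weighted by a function of the norm. -/
theorem lintegral_rpow_norm_mul {g : E → ℝ≥0∞} (hg : Measurable g) (a : ℝ) :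
    ∫⁻ x, ENNReal.ofReal (‖x‖ ^ (-a)) * g x =
      ∫⁻ ω, (∫⁻ t : ℝ, ENNReal.ofReal (Real.exp ((Module.finrank ℝ E - a) * t)) *
        g (Real.exp t • (ω : E))) ∂(volume : Measure E).toSphere := by
  rw [lintegral_eq_lintegral_sphere_exp _ (by fun_prop)]
  refine lintegral_congr fun ω => lintegral_congr fun t => ?_
  rw [← mul_assoc, ← ENNReal.ofReal_mul (Real.exp_nonneg _), norm_smul, Real.norm_of_nonneg
    (Real.exp_nonneg _), norm_eq_of_mem_sphere, mul_one, ← Real.exp_mul, ← Real.exp_add]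
  ring_nf

/-- Integrating out ω' first leaves the kernel at ω, which does not depend on ω. -/
theorem lintegral_pairMeasure_fst {g : E → ℝ≥0∞} (hg : Measurable g) (a τ : ℝ) {η : E}
    (hη : ‖η‖ = 1) :
    ∫⁻ z, g (Real.exp z.1.2 • (z.1.1 : E)) ∂(pairMeasure E a τ) =
      sphereKernel (Module.finrank ℝ E + a) τ η *
        ∫⁻ x, ENNReal.ofReal (‖x‖ ^ (-a)) * g x := by
  rw [pairMeasure, lintegral_withDensity_eq_lintegral_mul _ (by fun_prop) (by fun_prop),
    lintegral_prod _ (by fun_prop), lintegral_rpow_norm_mul hg, ← lintegral_prod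
      (fun z : Metric.sphere (0 : E) 1 × ℝ =>
        ENNReal.ofReal (Real.exp ((Module.finrank ℝ E - a) * z.2)) *
        g (Real.exp z.2 • (z.1 : E))) (by fun_prop), ← lintegral_const_mul _ (by fun_prop)]
  refine lintegral_congr fun z => ?_
  rw [← sphereKernel_eq_of_norm_eq _ _ (by simp [hη] : ‖(z.1 : E)‖ = ‖η‖), sphereKernel,
    ← lintegral_mul_const _ (by fun_prop)]
  refine lintegral_congr fun ω => ?_
  simp only [Pi.mul_apply]
  ring

/-- Here ω is integrated out, by the symmetry of the kernel in the two unit vectors. Translating t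
by τ in the weight e^((d-a)t) produces the exponential factor. -/
theorem lintegral_pairMeasure_snd {g : E → ℝ≥0∞} (hg : Measurable g) (a τ : ℝ) {η : E}
    (hη : ‖η‖ = 1) :
    ∫⁻ z, g (Real.exp (z.1.2 + τ) • (z.2 : E)) ∂(pairMeasure E a τ) =
      ENNReal.ofReal (Real.exp (-(Module.finrank ℝ E - a) * τ)) *
      (sphereKernel (Module.finrank ℝ E + a) τ η *
        ∫⁻ x, ENNReal.ofReal (‖x‖ ^ (-a)) * g x) := by
  rw [pairMeasure, lintegral_withDensity_eq_lintegral_mul _ (by fun_prop) (by fun_prop),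
    lintegral_prod_symm _ (by fun_prop), lintegral_rpow_norm_mul hg, ← mul_assoc,
    ← lintegral_const_mul _ (by fun_prop)]
  refine lintegral_congr fun ω' => ?_
  rw [lintegral_prod _ (by fun_prop), ← sphereKernel_eq_of_norm_eq _ _
    (by simp [hη] : ‖(ω' : E)‖ = ‖η‖), ← sphereKernel_comm _ _ (by simp), mul_assoc,
    mul_left_comm, ← lintegral_mul_const _ (by fun_prop)]
  refine lintegral_congr fun ω => ?_
  rw [← lintegral_add_right_eq_self (fun t => ENNReal.ofReal (Real.exp
    ((Module.finrank ℝ E - a) * t)) * g (Real.exp t • (ω' : E))) τ, ← lintegral_const_mul _ (by fun_prop),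
    ← lintegral_const_mul _ (by fun_prop)]
  refine lintegral_congr fun t => ?_
  simp only [Pi.mul_apply]
  have : Real.exp ((Module.finrank ℝ E - a) * t) = Real.exp (-(Module.finrank ℝ E - a) * τ) *
      Real.exp ((Module.finrank ℝ E - a) * (t + τ)) := by
    rw [← Real.exp_add]; ring_nf
  rw [this, ENNReal.ofReal_mul (Real.exp_nonneg _)]
  ring

/-- A double integral against `‖x - y‖^(-d-a)`, disintegrated along the ratio of the radii. -/
theorem lintegral_prod_eq_lintegral_pairMeasure {G : E × E → ℝ≥0∞} (hG : Measurable G) (a : ℝ) :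
    ∫⁻ z : E × E, ENNReal.ofReal (‖z.1 - z.2‖ ^ (-(Module.finrank ℝ E + a))) * G z =
      ∫⁻ τ : ℝ, ENNReal.ofReal (Real.exp (Module.finrank ℝ E * τ)) *
        ∫⁻ z, G (Real.exp z.1.2 • (z.1.1 : E), Real.exp (z.1.2 + τ) • (z.2 : E))
          ∂(pairMeasure E a τ) := by
  set d : ℝ := (Module.finrank ℝ E : ℝ)
  rw [Measure.volume_eq_prod, lintegral_prod _ (by fun_prop),
    lintegral_eq_lintegral_sphere_exp _ (by fun_prop)]
  let Q : ((Metric.sphere (0 : E) 1 × ℝ) × Metric.sphere (0 : E) 1) → ℝ → ℝ≥0∞ := fun z τ =>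
    ENNReal.ofReal (Real.exp (d * τ)) *
      (ENNReal.ofReal (Real.exp ((d - a) * z.1.2)) *
      ENNReal.ofReal (‖(z.1.1 : E) - Real.exp τ • (z.2 : E)‖ ^ (-(d + a))) *
      G (Real.exp z.1.2 • (z.1.1 : E), Real.exp (z.1.2 + τ) • (z.2 : E)))
  have hQ : Measurable (Function.uncurry Q) := by
    simp only [Q, Function.uncurry_def]; fun_prop
  have hR : ∀ τ : ℝ, ENNReal.ofReal (Real.exp (d * τ)) *
        ∫⁻ z, G (Real.exp z.1.2 • (z.1.1 : E), Real.exp (z.1.2 + τ) • (z.2 : E))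
          ∂(pairMeasure E a τ) = ∫⁻ z, Q z τ ∂(((volume : Measure E).toSphere.prod volume).prod
            (volume : Measure E).toSphere) := by
    intro τ
    rw [pairMeasure, lintegral_withDensity_eq_lintegral_mul _ (by fun_prop) (by fun_prop),
      ← lintegral_const_mul _ (by fun_prop)]
    rfl
  simp_rw [hR]
  have : SFinite (((volume : Measure E).toSphere.prod (volume : Measure ℝ)).prod
      (volume : Measure E).toSphere) := Measure.prod.instSFinite
  have hswap := lintegral_lintegral_swap (μ := ((volume : Measure E).toSphere.prod
    (volume : Measure ℝ)).prod (volume : Measure E).toSphere) (ν := (volume : Measure ℝ))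
    hQ.aemeasurable
  rw [← hswap, lintegral_prod _ hQ.lintegral_prod_right.aemeasurable,
    lintegral_prod _ (Measurable.lintegral_prod_right' hQ.lintegral_prod_right).aemeasurable]
  refine lintegral_congr fun ω => lintegral_congr fun t => ?_
  rw [lintegral_eq_lintegral_sphere_exp _ (by fun_prop), ← lintegral_const_mul _ (by fun_prop)]
  refine lintegral_congr fun ω' => ?_
  -- The logarithmic radius of y is recentred at that of x. By homogeneity the exponents then
  -- combine as dt + d(t + τ) - (d + a)t = dτ + (d - a)t.
  rw [← lintegral_add_left_eq_self _ t, ← lintegral_const_mul _ (by fun_prop)]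
  refine lintegral_congr fun τ => ?_
  have h1 : ‖Real.exp t • (ω : E) - Real.exp (t + τ) • (ω' : E)‖ =
      Real.exp t * ‖(ω : E) - Real.exp τ • (ω' : E)‖ := by
    rw [Real.exp_add, mul_smul, ← smul_sub, norm_smul, Real.norm_of_nonneg (Real.exp_nonneg _)]
  simp only [Q, h1]
  rw [← mul_assoc, ← mul_assoc, ← mul_assoc, ← mul_assoc]
  congr 1
  rw [← ENNReal.ofReal_mul (by positivity), ← ENNReal.ofReal_mul (by positivity),
    ← ENNReal.ofReal_mul (by positivity), ← ENNReal.ofReal_mul (by positivity),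
    Real.mul_rpow (Real.exp_nonneg _) (norm_nonneg _), ← Real.exp_mul]
  congr 1
  rw [← mul_assoc, ← Real.exp_add, ← Real.exp_add, ← Real.exp_add]
  congr 2
  ring

end LogPolar

/-! ### The inequality -/

section LowerBound

theorem lintegral_rpow_le_of_le_add {α : Type*} {_ : MeasurableSpace α} {μ : Measure α} {p : ℝ}
    (hp : 1 ≤ p) {f g h : α → ℝ≥0∞} (hg : Measurable g) (hh : Measurable h)
    (hle : ∀ x, f x ≤ g x + h x) :
    (∫⁻ x, f x ^ p ∂μ) ^ (1 / p) ≤ (∫⁻ x, g x ^ p ∂μ) ^ (1 / p) + (∫⁻ x, h x ^ p ∂μ) ^ (1 / p) := by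
  refine le_trans ?_ (ENNReal.lintegral_Lp_add_le hg.aemeasurable hh.aemeasurable hp)
  gcongr with x
  exact hle x

/-- The reverse triangle inequality in `ℝ≥0∞`: finiteness of A permits the subtraction, and the sign
of 1 - c decides which bound is used. -/
theorem ENNReal.ofReal_abs_one_sub_mul_le {c : ℝ} (hc : 0 ≤ c) {A J : ℝ≥0∞} (hA : A ≠ ∞)
    (h1 : A ≤ J + ENNReal.ofReal c * A) (h2 : ENNReal.ofReal c * A ≤ J + A) :
    ENNReal.ofReal |1 - c| * A ≤ J := by
  rcases le_total c 1 with h | h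
  · rw [abs_of_nonneg (by linarith), ENNReal.ofReal_sub _ hc, ENNReal.sub_mul fun _ _ => hA,
      tsub_le_iff_right]
    simpa using h1
  · rw [abs_sub_comm, abs_of_nonneg (by linarith), ENNReal.ofReal_sub _ zero_le_one,
      ENNReal.sub_mul fun _ _ => hA, tsub_le_iff_right]
    simpa using h2

variable {E : Type*} [NormedAddCommGroup E] [InnerProductSpace ℝ E] [MeasurableSpace E]
  [BorelSpace E] [FiniteDimensional ℝ E] [Nontrivial E]
  {F : Type*} [NormedAddCommGroup F] [MeasurableSpace F] [BorelSpace F]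
  [SecondCountableTopology F]

theorem ofReal_exp_mul_rpow_one_div {p l b τ : ℝ} (hp : 0 < p) (hl : p * l = b) (X : ℝ≥0∞) :
    (ENNReal.ofReal (Real.exp (-b * τ)) * X) ^ (1 / p) =
      ENNReal.ofReal (Real.exp (-l * τ)) * X ^ (1 / p) := by
  rw [ENNReal.mul_rpow_of_nonneg _ _ (by positivity), ENNReal.ofReal_rpow_of_nonneg
    (Real.exp_nonneg _) (by positivity), ← Real.exp_mul, ← hl]
  congr 3
  field_simp

/-- For a fixed ratio of the radii, Minkowski's inequality bounds the energy from below. -/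
theorem le_lintegral_pairMeasure {f : E → F} (hf : Measurable f) {p a l : ℝ} (hp : 1 ≤ p)
    (hl : p * l = Module.finrank ℝ E - a) (ha : 0 ≤ a) {η : E} (hη : ‖η‖ = 1)
    (hfin : ∫⁻ x, ENNReal.ofReal (‖x‖ ^ (-a)) * ‖f x‖ₑ ^ p ≠ ∞) (τ : ℝ) :
    ENNReal.ofReal (|1 - Real.exp (-l * τ)| ^ p) *
        (sphereKernel (Module.finrank ℝ E + a) τ η *
          ∫⁻ x, ENNReal.ofReal (‖x‖ ^ (-a)) * ‖f x‖ₑ ^ p) ≤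
      ∫⁻ z, ‖f (Real.exp z.1.2 • (z.1.1 : E)) - f (Real.exp (z.1.2 + τ) • (z.2 : E))‖ₑ ^ p
        ∂(pairMeasure E a τ) := by
  have hp0 : 0 < p := by linarith
  -- At τ = 0 the kernel need not be finite, but the factor |1 - e^0|^p vanishes and 0 · ∞ = 0.
  rcases eq_or_ne τ 0 with rfl | hτ
  · simp [Real.zero_rpow hp0.ne']
  have hK := (sphereKernel_lt_top (s := Module.finrank ℝ E + a) (by positivity) hτ hη).ne
  have hfst := lintegral_pairMeasure_fst (g := fun x => ‖f x‖ₑ ^ p) (by fun_prop) a τ hη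
  have hsnd := lintegral_pairMeasure_snd (g := fun x => ‖f x‖ₑ ^ p) (by fun_prop) a τ hη
  set X := sphereKernel (Module.finrank ℝ E + a) τ η *
    ∫⁻ x, ENNReal.ofReal (‖x‖ ^ (-a)) * ‖f x‖ₑ ^ p with hX
  have hXfin : X ≠ ∞ := ENNReal.mul_ne_top hK hfin
  set J := ∫⁻ z, ‖f (Real.exp z.1.2 • (z.1.1 : E)) - f (Real.exp (z.1.2 + τ) • (z.2 : E))‖ₑ ^ p
        ∂(pairMeasure E a τ) with hJ
  have key : ENNReal.ofReal |1 - Real.exp (-l * τ)| * X ^ (1 / p) ≤ J ^ (1 / p) := by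
    refine ENNReal.ofReal_abs_one_sub_mul_le (Real.exp_nonneg _) (by simp [hXfin, hp0.le]) ?_ ?_
    · rw [← ofReal_exp_mul_rpow_one_div hp0 hl, ← hsnd, ← hfst, hJ]
      refine lintegral_rpow_le_of_le_add hp (by fun_prop) (by fun_prop) fun z => ?_
      simpa using enorm_add_le (f (Real.exp z.1.2 • (z.1.1 : E)) -
        f (Real.exp (z.1.2 + τ) • (z.2 : E))) (f (Real.exp (z.1.2 + τ) • (z.2 : E)))
    · rw [← ofReal_exp_mul_rpow_one_div hp0 hl, ← hsnd, ← hfst, hJ]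
      refine lintegral_rpow_le_of_le_add hp (by fun_prop) (by fun_prop) fun z => ?_
      have := enorm_sub_le (E := F) (a := f (Real.exp z.1.2 • (z.1.1 : E)))
        (b := f (Real.exp z.1.2 • (z.1.1 : E)) - f (Real.exp (z.1.2 + τ) • (z.2 : E)))
      rw [sub_sub_cancel] at this
      exact this.trans (add_comm _ _).le
  have := ENNReal.rpow_le_rpow key hp0.le
  rwa [ENNReal.mul_rpow_of_nonneg _ _ hp0.le, ← ENNReal.rpow_mul, ← ENNReal.rpow_mul,
    one_div_mul_cancel hp0.ne', ENNReal.rpow_one, ENNReal.rpow_one,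
    ENNReal.ofReal_rpow_of_nonneg (abs_nonneg _) hp0.le] at this

/-- The constant of the inequality in logarithmic polar coordinates. -/
theorem lintegral_one_sub_rpow_eq (p l s : ℝ) (η : E) :
    ∫⁻ x : E, ENNReal.ofReal (|1 - ‖x‖ ^ (-l)| ^ p * ‖x - η‖ ^ (-s)) =
      ∫⁻ τ : ℝ, ENNReal.ofReal (Real.exp (Module.finrank ℝ E * τ)) *
        (ENNReal.ofReal (|1 - Real.exp (-l * τ)| ^ p) * sphereKernel s τ η) := by
  rw [lintegral_eq_lintegral_sphere_exp _ (by fun_prop), lintegral_lintegral_swap (by fun_prop)]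
  refine lintegral_congr fun τ => ?_
  rw [sphereKernel, ← lintegral_const_mul _ (by fun_prop), ← lintegral_const_mul _ (by fun_prop)]
  refine lintegral_congr fun ω => ?_
  rw [ENNReal.ofReal_mul (by positivity), norm_smul, Real.norm_of_nonneg (Real.exp_nonneg _),
    norm_eq_of_mem_sphere, mul_one, ← Real.exp_mul, norm_sub_rev, mul_comm τ]

theorem mul_lintegral_le_lintegral_prod {f : E → F} (hf : Measurable f) {p a l : ℝ} (hp : 1 ≤ p)
    (hl : p * l = Module.finrank ℝ E - a) (ha : 0 ≤ a) {η : E} (hη : ‖η‖ = 1)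
    (hfin : ∫⁻ x, ENNReal.ofReal (‖x‖ ^ (-a)) * ‖f x‖ₑ ^ p ≠ ∞) :
    (∫⁻ x : E, ENNReal.ofReal (|1 - ‖x‖ ^ (-l)| ^ p * ‖x - η‖ ^ (-(Module.finrank ℝ E + a)))) *
        ∫⁻ x, ENNReal.ofReal (‖x‖ ^ (-a)) * ‖f x‖ₑ ^ p ≤
      ∫⁻ z : E × E, ENNReal.ofReal (‖z.1 - z.2‖ ^ (-(Module.finrank ℝ E + a))) *
        ‖f z.1 - f z.2‖ₑ ^ p := by
  rw [lintegral_prod_eq_lintegral_pairMeasure (by fun_prop), lintegral_one_sub_rpow_eq,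
    ← lintegral_mul_const' _ _ hfin]
  refine lintegral_mono fun τ => ?_
  have := le_lintegral_pairMeasure hf hp hl ha hη hfin τ
  simp only [mul_assoc]
  gcongr

end LowerBound

/-! ### Finiteness of the Hardy integral -/

theorem SchwartzMap.lintegral_rpow_norm_mul_lt_top {E : Type*} [NormedAddCommGroup E]
    [InnerProductSpace ℝ E] [MeasurableSpace E] [BorelSpace E] [FiniteDimensional ℝ E]
    [Nontrivial E] {F : Type*} [NormedAddCommGroup F] [NormedSpace ℝ F] [MeasurableSpace F]
    [BorelSpace F] (f : 𝓢(E, F)) {p a : ℝ} (hp : 1 ≤ p)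
    (ha : 0 < a) (had : a < Module.finrank ℝ E) :
    ∫⁻ x, ENNReal.ofReal (‖x‖ ^ (-a)) * ‖f x‖ₑ ^ p < ∞ := by
  have hp0 : 0 < p := by linarith
  set d : ℝ := (Module.finrank ℝ E : ℝ) with hd
  -- Boundedness of f suffices near the origin, as a < d; decay of order d suffices at infinity, as
  -- a > 0 and p ≥ 1.
  obtain ⟨C₁, hC₁, h₁⟩ := f.decay 0 0
  obtain ⟨C₂, hC₂, h₂⟩ := f.decay (Module.finrank ℝ E) 0
  simp only [pow_zero, one_mul, norm_iteratedFDeriv_zero] at h₁ h₂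
  have hm : Measurable fun x => ‖f x‖ₑ ^ p := by
    have := f.continuous
    fun_prop
  rw [_root_.lintegral_rpow_norm_mul hm]
  set M := ENNReal.ofReal (C₁ ^ p) * ∫⁻ t in Set.Iic (0 : ℝ), ENNReal.ofReal (Real.exp ((d - a) * t))
    with hM
  set N := ENNReal.ofReal (C₂ ^ p) * ∫⁻ t in Set.Ioi (0 : ℝ), ENNReal.ofReal (Real.exp (-a * t))
    with hN
  have hMfin : M < ∞ := ENNReal.mul_lt_top ENNReal.ofReal_lt_top
    (integrableOn_exp_mul_Iic (by linarith) _).lintegral_lt_top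
  have hNfin : N < ∞ := ENNReal.mul_lt_top ENNReal.ofReal_lt_top
    (integrableOn_exp_mul_Ioi (by linarith) _).lintegral_lt_top
  refine lt_of_le_of_lt (lintegral_mono (g := fun _ => M + N) fun ω => ?_) ?_
  · rw [← lintegral_add_compl _ (measurableSet_Iic (a := (0 : ℝ))), Set.compl_Iic, hM, hN,
      ← lintegral_const_mul _ (by fun_prop), ← lintegral_const_mul _ (by fun_prop)]
    refine add_le_add (lintegral_mono fun t => ?_) (setLIntegral_mono (by fun_prop) fun t ht => ?_)
    · rw [mul_comm, ← ofReal_norm, ENNReal.ofReal_rpow_of_nonneg (norm_nonneg _) hp0.le]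
      gcongr
      exact h₁ _
    · rw [← ofReal_norm, ENNReal.ofReal_rpow_of_nonneg (norm_nonneg _) hp0.le,
        ← ENNReal.ofReal_mul (Real.exp_nonneg _), ← ENNReal.ofReal_mul (by positivity)]
      refine ENNReal.ofReal_le_ofReal ?_
      have h3 := h₂ (Real.exp t • (ω : E))
      rw [norm_smul, Real.norm_of_nonneg (Real.exp_nonneg _), norm_eq_of_mem_sphere, mul_one,
        ← Real.exp_nat_mul, ← hd] at h3
      have h4 := Real.rpow_le_rpow (by positivity) h3 hp0.le
      rw [Real.mul_rpow (by positivity) (by positivity), ← Real.exp_mul] at h4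
      -- For t ≥ 0 and p ≥ 1 the decay e^(-dtp) absorbs the volume factor e^(dt).
      have h5 : Real.exp ((d - a) * t) ≤ Real.exp (d * t * p) * Real.exp (-a * t) := by
        rw [← Real.exp_add]
        refine Real.exp_le_exp.2 ?_
        have : 0 ≤ d * t := mul_nonneg (by linarith) (le_of_lt ht)
        nlinarith
      calc _ ≤ Real.exp (d * t * p) * Real.exp (-a * t) * ‖f (Real.exp t • (ω : E))‖ ^ p := by
            gcongr
        _ = Real.exp (d * t * p) * ‖f (Real.exp t • (ω : E))‖ ^ p * Real.exp (-a * t) := by ring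
        _ ≤ _ := by gcongr
  · rw [lintegral_const]
    exact ENNReal.mul_lt_top (ENNReal.add_lt_top.2 ⟨hMfin, hNfin⟩) (measure_lt_top _ _)

/-! ### Truncated powers as almost-extremal functions -/

section CutoffPower

open Filter Topology

variable {E : Type*} [NormedAddCommGroup E]

/-- The power `‖x‖^(-l)`, cut off smoothly where `|log ‖x‖|` exceeds a multiple of `N`. -/
noncomputable def cutoffPower (χ : ContDiffBump (0 : ℝ)) (l N : ℝ) (x : E) : ℝ :=
  ‖x‖ ^ (-l) * χ (Real.log ‖x‖ / N)

theorem cutoffPower_eq_zero (χ : ContDiffBump (0 : ℝ)) (l : ℝ) {N : ℝ} (hN : 0 < N) {x : E}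
    (hx : χ.rOut * N ≤ |Real.log ‖x‖|) : cutoffPower χ l N x = 0 := by
  rw [cutoffPower, χ.zero_of_le_dist, mul_zero]
  rwa [Real.dist_eq, sub_zero, abs_div, abs_of_pos hN, le_div_iff₀ hN]

variable [InnerProductSpace ℝ E]

theorem cutoffPower_exp_smul (χ : ContDiffBump (0 : ℝ)) (l N t : ℝ) {u : E} (hu : ‖u‖ = 1) :
    cutoffPower χ l N (Real.exp t • u) = Real.exp (-l * t) * χ (t / N) := by
  rw [cutoffPower, norm_smul, hu, mul_one, Real.norm_of_nonneg (Real.exp_nonneg _),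
    ← Real.exp_mul, Real.log_exp, mul_comm t]

theorem contDiff_cutoffPower (χ : ContDiffBump (0 : ℝ)) {l N : ℝ} (hl : l ≠ 0) (hN : 0 < N)
    {k : ℕ∞} : ContDiff ℝ k (cutoffPower χ l N : E → ℝ) := by
  rw [contDiff_iff_contDiffAt]
  intro x
  rcases eq_or_ne x 0 with rfl | hx
  · refine (contDiffAt_const (c := (0 : ℝ))).congr_of_eventuallyEq ?_
    filter_upwards [Metric.ball_mem_nhds (0 : E) (Real.exp_pos (-(χ.rOut * N)))] with y hy
    rw [mem_ball_zero_iff] at hy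
    rcases eq_or_ne y 0 with rfl | hy0
    -- At the origin the cutoff gives no help, since `Real.log 0 = 0`; the value is 0 because `0 ^
    -- (-l) = 0` for l ≠ 0.
    · simp [cutoffPower, hl]
    · have h := (Real.log_lt_iff_lt_exp (norm_pos_iff.2 hy0)).2 hy
      refine cutoffPower_eq_zero χ l hN (le_abs.2 (Or.inr ?_))
      linarith
  · have hn : ‖x‖ ≠ 0 := norm_ne_zero_iff.2 hx
    have h1 : ContDiffAt ℝ k (fun y : E => ‖y‖) x := contDiffAt_norm ℝ hx
    exact (h1.rpow_const_of_ne hn).mul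
      (χ.contDiff.contDiffAt.comp x ((h1.log hn).div_const N))

theorem hasCompactSupport_cutoffPower [FiniteDimensional ℝ E] (χ : ContDiffBump (0 : ℝ))
    (l : ℝ) {N : ℝ} (hN : 0 < N) : HasCompactSupport (cutoffPower χ l N : E → ℝ) := by
  have : ProperSpace E := FiniteDimensional.proper_real E
  refine HasCompactSupport.intro (isCompact_closedBall (0 : E) (Real.exp (χ.rOut * N))) fun x hx => ?_
  rw [mem_closedBall_zero_iff, not_le] at hx
  have hpos := (Real.exp_pos _).trans hx
  exact cutoffPower_eq_zero χ l hN (le_abs.2 (Or.inl ((Real.lt_log_iff_exp_lt hpos).2 hx).le))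

/-- `cutoffPower` as a Schwartz function. -/
noncomputable def cutoffPowerSchwartz [FiniteDimensional ℝ E] (𝕜 : Type*) [RCLike 𝕜]
    (χ : ContDiffBump (0 : ℝ)) {l N : ℝ} (hl : l ≠ 0) (hN : 0 < N) : 𝓢(E, 𝕜) :=
  HasCompactSupport.toSchwartzMap (f := fun x => (RCLike.ofReal (cutoffPower χ l N x) : 𝕜))
    ((hasCompactSupport_cutoffPower χ l hN).comp_left RCLike.ofReal_zero)
    ((RCLike.ofRealCLM (K := 𝕜)).contDiff.comp (contDiff_cutoffPower χ hl hN))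

@[simp]
theorem cutoffPowerSchwartz_apply [FiniteDimensional ℝ E] (𝕜 : Type*) [RCLike 𝕜]
    (χ : ContDiffBump (0 : ℝ)) {l N : ℝ} (hl : l ≠ 0) (hN : 0 < N) (x : E) :
    cutoffPowerSchwartz 𝕜 χ hl hN x = (RCLike.ofReal (cutoffPower χ l N x) : 𝕜) :=
  rfl

theorem exists_abs_sub_le_min (χ : ContDiffBump (0 : ℝ)) :
    ∃ L : ℝ, 0 < L ∧ ∀ s t : ℝ, |χ s - χ t| ≤ min 1 (L * |s - t|) := by
  obtain ⟨L, hL⟩ := χ.contDiff.lipschitzWith_of_hasCompactSupport χ.hasCompactSupport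
    (n := 1) one_ne_zero
  -- Adding 1 makes the Lipschitz constant positive.
  refine ⟨L + 1, by positivity, fun s t => le_min ?_ ?_⟩
  · rw [abs_le]
    constructor <;> linarith [χ.nonneg' s, χ.nonneg' t, χ.le_one (x := s), χ.le_one (x := t)]
  · have := hL.dist_le_mul s t
    rw [Real.dist_eq, Real.dist_eq] at this
    nlinarith [abs_nonneg (s - t)]

variable [MeasurableSpace E] [BorelSpace E] [FiniteDimensional ℝ E] [Nontrivial E]

/-- Since a + pl = d, the powers of |x| cancel the Jacobian e^(dt) exactly and leave dt. -/
theorem lintegral_rpow_norm_mul_comp_log {p a l : ℝ} (hp : 0 ≤ p)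
    (hl : p * l = Module.finrank ℝ E - a) {k : ℝ → ℝ} (hk : Measurable k) :
    ∫⁻ x : E, ENNReal.ofReal (‖x‖ ^ (-a)) *
        ENNReal.ofReal (‖x‖ ^ (-l) * k (Real.log ‖x‖)) ^ p =
      (∫⁻ t, ENNReal.ofReal (k t) ^ p) * (volume : Measure E).toSphere Set.univ := by
  rw [lintegral_rpow_norm_mul (by fun_prop), ← lintegral_const]
  refine lintegral_congr fun ω => lintegral_congr fun t => ?_
  rw [norm_smul, norm_eq_of_mem_sphere, mul_one, Real.norm_of_nonneg (Real.exp_nonneg _),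
    ← Real.exp_mul, Real.log_exp, ENNReal.ofReal_mul (Real.exp_nonneg _),
    ENNReal.mul_rpow_of_nonneg _ _ hp, ENNReal.ofReal_rpow_of_nonneg (Real.exp_nonneg _) hp,
    ← Real.exp_mul, ← mul_assoc, ← ENNReal.ofReal_mul (Real.exp_nonneg _), ← Real.exp_add, ← hl]
  ring_nf
  simp

theorem lintegral_cutoffPower_eq (χ : ContDiffBump (0 : ℝ)) {p a l : ℝ} (hp : 0 ≤ p)
    (hl : p * l = Module.finrank ℝ E - a) (N : ℝ) :
    ∫⁻ x : E, ENNReal.ofReal (‖x‖ ^ (-a)) * ‖cutoffPower χ l N x‖ₑ ^ p =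
      (∫⁻ t, ENNReal.ofReal (χ (t / N)) ^ p) * (volume : Measure E).toSphere Set.univ := by
  have := χ.continuous
  rw [← lintegral_rpow_norm_mul_comp_log hp hl (by fun_prop)]
  refine lintegral_congr fun x => ?_
  rw [← Real.enorm_of_nonneg (mul_nonneg (by positivity) (χ.nonneg' _)), cutoffPower]

theorem le_lintegral_bump_rpow (χ : ContDiffBump (0 : ℝ)) {N p : ℝ} (hN : 0 < N) :
    ENNReal.ofReal (2 * χ.rIn * N) ≤ ∫⁻ t, ENNReal.ofReal (χ (t / N)) ^ p := by
  calc ENNReal.ofReal (2 * χ.rIn * N) = ∫⁻ _ in Set.Icc (-(χ.rIn * N)) (χ.rIn * N), 1 := by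
        rw [setLIntegral_one, Real.volume_Icc]; ring_nf
    _ ≤ ∫⁻ t in Set.Icc (-(χ.rIn * N)) (χ.rIn * N), ENNReal.ofReal (χ (t / N)) ^ p := by
        have := χ.continuous
        refine setLIntegral_mono (by fun_prop) fun t ht => ?_
        rw [χ.one_of_mem_closedBall, ENNReal.ofReal_one, ENNReal.one_rpow]
        rw [mem_closedBall_zero_iff, Real.norm_eq_abs, abs_div, abs_of_pos hN, div_le_iff₀ hN]
        exact abs_le.2 ht
    _ ≤ _ := setLIntegral_le_lintegral _ _

theorem lintegral_bump_sub_rpow_le (χ : ContDiffBump (0 : ℝ)) {N p m τ : ℝ} (hN : 0 < N)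
    (hp : 0 < p) (hm : ∀ t, |χ (t / N) - χ ((t + τ) / N)| ≤ m) :
    ∫⁻ t, ENNReal.ofReal |χ (t / N) - χ ((t + τ) / N)| ^ p ≤
      ENNReal.ofReal (4 * χ.rOut * N) * ENNReal.ofReal m ^ p := by
  set R := χ.rOut * N with hR
  have hR0 : 0 < R := mul_pos χ.rOut_pos hN
  -- Off these two intervals, each of length 2R, both bumps vanish.
  set S := Set.Icc (-R) R ∪ Set.Icc (-R - τ) (R - τ) with hS
  have hzero : ∀ t, R ≤ |t| → χ (t / N) = 0 := fun t ht => χ.zero_of_le_dist <| by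
    rwa [Real.dist_eq, sub_zero, abs_div, abs_of_pos hN, le_div_iff₀ hN]
  calc ∫⁻ t, ENNReal.ofReal |χ (t / N) - χ ((t + τ) / N)| ^ p
      ≤ ∫⁻ t, S.indicator (fun _ => ENNReal.ofReal m ^ p) t := by
        refine lintegral_mono fun t => ?_
        by_cases ht : t ∈ S
        · rw [Set.indicator_of_mem ht]
          gcongr
          exact hm t
        · rw [hS, Set.mem_union, not_or, Set.mem_Icc, Set.mem_Icc] at ht
          rw [hzero t, hzero (t + τ)]
          · simp [hp]
          · refine le_of_not_ge fun h => ht.2 ?_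
            rw [abs_le] at h
            constructor <;> linarith
          · refine le_of_not_ge fun h => ht.1 ?_
            rwa [abs_le] at h
    _ = volume S * ENNReal.ofReal m ^ p := by
        rw [lintegral_indicator_const (measurableSet_Icc.union measurableSet_Icc), mul_comm]
    _ ≤ _ := by
        gcongr
        refine (measure_union_le _ _).trans ?_
        rw [Real.volume_Icc, Real.volume_Icc, ← ENNReal.ofReal_add (by linarith) (by linarith)]
        exact ENNReal.ofReal_le_ofReal (by linarith)

/-- For a fixed ratio of the radii, the energy of `cutoffPower` is close to its lower bound. -/
theorem lintegral_pairMeasure_cutoffPower_le (χ : ContDiffBump (0 : ℝ)) {p a l N m τ : ℝ}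
    (hp : 1 ≤ p) (hl : p * l = Module.finrank ℝ E - a) (hN : 0 < N) (hm0 : 0 ≤ m)
    (hm : ∀ t, |χ (t / N) - χ ((t + τ) / N)| ≤ m) {η : E} (hη : ‖η‖ = 1)
    (hl0 : l ≠ 0) :
    ∫⁻ z, ‖cutoffPower χ l N (Real.exp z.1.2 • (z.1.1 : E)) -
        cutoffPower χ l N (Real.exp (z.1.2 + τ) • (z.2 : E))‖ₑ ^ p ∂(pairMeasure E a τ) ≤
      ENNReal.ofReal ((|1 - Real.exp (-l * τ)| +
          2 * (χ.rOut / χ.rIn) * (Real.exp (-l * τ) * m)) ^ p) *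
        (sphereKernel (Module.finrank ℝ E + a) τ η *
          ∫⁻ x : E, ENNReal.ofReal (‖x‖ ^ (-a)) * ‖cutoffPower χ l N x‖ₑ ^ p) := by
  have hp0 : 0 < p := by linarith
  have hχ := χ.continuous
  have hcm : Measurable (cutoffPower χ l N : E → ℝ) :=
    (contDiff_cutoffPower (k := 0) χ hl0 hN).continuous.measurable
  have hr : 1 ≤ 2 * (χ.rOut / χ.rIn) := by linarith [χ.one_lt_rOut_div_rIn]
  set u := Real.exp (-l * τ) with hu
  have hu0 : 0 < u := Real.exp_pos _
  set Φ := sphereKernel (Module.finrank ℝ E + a) τ η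
  have hH := lintegral_cutoffPower_eq (E := E) χ hp0.le hl N
  set H := ∫⁻ x : E, ENNReal.ofReal (‖x‖ ^ (-a)) * ‖cutoffPower χ l N x‖ₑ ^ p
  set J := ∫⁻ z, ‖cutoffPower χ l N (Real.exp z.1.2 • (z.1.1 : E)) -
    cutoffPower χ l N (Real.exp (z.1.2 + τ) • (z.2 : E))‖ₑ ^ p ∂(pairMeasure E a τ) with hJ
  -- With f = `cutoffPower χ l N`, the difference f(x) - f(y) splits as (1 - u) f(x) + u |x|^(-l)
  -- (χ(t/N) - χ((t+τ)/N)). Both terms depend on x alone for given τ, so `lintegral_pairMeasure_fst`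
  -- evaluates both.
  let g₁ : E → ℝ≥0∞ := fun x => ENNReal.ofReal |1 - u| * ‖cutoffPower χ l N x‖ₑ
  let g₂ : E → ℝ≥0∞ := fun x => ENNReal.ofReal u * ENNReal.ofReal (‖x‖ ^ (-l) *
    |χ (Real.log ‖x‖ / N) - χ ((Real.log ‖x‖ + τ) / N)|)
  have hg₁ : Measurable g₁ := by fun_prop
  have hg₂ : Measurable g₂ := by fun_prop
  have hle : J ^ (1 / p) ≤
      (∫⁻ z, g₁ (Real.exp z.1.2 • (z.1.1 : E)) ^ p ∂(pairMeasure E a τ)) ^ (1 / p) +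
      (∫⁻ z, g₂ (Real.exp z.1.2 • (z.1.1 : E)) ^ p ∂(pairMeasure E a τ)) ^ (1 / p) := by
    refine lintegral_rpow_le_of_le_add hp (by fun_prop) (by fun_prop) fun z => ?_
    simp only [g₁, g₂]
    rw [ENNReal.ofReal_mul (by positivity), ← Real.enorm_eq_ofReal_abs, ← Real.enorm_eq_ofReal_abs,
      ← Real.enorm_of_nonneg hu0.le,
      ← Real.enorm_of_nonneg (by positivity : 0 ≤ ‖Real.exp z.1.2 • (z.1.1 : E)‖ ^ (-l)),
      ← enorm_mul, ← enorm_mul, ← enorm_mul]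
    refine le_trans (le_of_eq ?_) (enorm_add_le _ _)
    congr 1
    rw [cutoffPower_exp_smul _ _ _ _ (by simp), cutoffPower_exp_smul _ _ _ _ (by simp),
      norm_smul, norm_eq_of_mem_sphere, mul_one, Real.norm_of_nonneg (Real.exp_nonneg _),
      ← Real.exp_mul, Real.log_exp, mul_add, Real.exp_add, ← hu, mul_comm z.1.2]
    ring
  have h₁ : (∫⁻ z, g₁ (Real.exp z.1.2 • (z.1.1 : E)) ^ p ∂(pairMeasure E a τ)) ^ (1 / p) =
      ENNReal.ofReal |1 - u| * (Φ * H) ^ (1 / p) := by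
    simp only [g₁, ENNReal.mul_rpow_of_nonneg _ _ hp0.le]
    rw [lintegral_const_mul _ (by fun_prop), lintegral_pairMeasure_fst
      (g := fun x => ‖cutoffPower χ l N x‖ₑ ^ p) (by fun_prop) a τ hη,
      ENNReal.mul_rpow_of_nonneg _ _ (by positivity), ← ENNReal.rpow_mul,
      mul_one_div_cancel hp0.ne', ENNReal.rpow_one]
  have h₂ : (∫⁻ z, g₂ (Real.exp z.1.2 • (z.1.1 : E)) ^ p ∂(pairMeasure E a τ)) ^ (1 / p) ≤
      ENNReal.ofReal (2 * (χ.rOut / χ.rIn) * (u * m)) * (Φ * H) ^ (1 / p) := by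
    have h3 : (∫⁻ t, ENNReal.ofReal |χ (t / N) - χ ((t + τ) / N)| ^ p) ≤
        (ENNReal.ofReal (2 * (χ.rOut / χ.rIn)) * ENNReal.ofReal m) ^ p *
          ∫⁻ t, ENNReal.ofReal (χ (t / N)) ^ p := by
      refine (lintegral_bump_sub_rpow_le χ hN hp0 hm).trans ?_
      -- The support bound 4 rOut N is measured against 2 rIn N, a lower bound for the integral of
      -- χ^p. The ratio is at least 1, hence at most its own p-th power.
      have h4 : ENNReal.ofReal (4 * χ.rOut * N) =
          ENNReal.ofReal (2 * (χ.rOut / χ.rIn)) * ENNReal.ofReal (2 * χ.rIn * N) := by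
        rw [← ENNReal.ofReal_mul (by positivity)]
        congr 1
        have := χ.rIn_pos.ne'
        field_simp
        ring
      rw [h4, ENNReal.mul_rpow_of_nonneg _ _ hp0.le, mul_right_comm]
      gcongr
      · exact ENNReal.le_rpow_self_of_one_le (ENNReal.one_le_ofReal.2 hr) hp
      · exact le_lintegral_bump_rpow χ hN
    simp only [g₂, ENNReal.mul_rpow_of_nonneg _ _ hp0.le]
    rw [lintegral_const_mul _ (by fun_prop), lintegral_pairMeasure_fst
      (g := fun x => ENNReal.ofReal (‖x‖ ^ (-l) *
        |χ (Real.log ‖x‖ / N) - χ ((Real.log ‖x‖ + τ) / N)|) ^ p) (by fun_prop) a τ hη,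
      lintegral_rpow_norm_mul_comp_log (k := fun t => |χ (t / N) - χ ((t + τ) / N)|)
        hp0.le hl (by fun_prop)]
    calc (ENNReal.ofReal u ^ p * (Φ * ((∫⁻ t, ENNReal.ofReal |χ (t / N) - χ ((t + τ) / N)| ^ p) *
          (volume : Measure E).toSphere Set.univ))) ^ (1 / p)
        ≤ (ENNReal.ofReal u ^ p * (Φ * (((ENNReal.ofReal (2 * (χ.rOut / χ.rIn)) *
          ENNReal.ofReal m) ^ p * ∫⁻ t, ENNReal.ofReal (χ (t / N)) ^ p) *
          (volume : Measure E).toSphere Set.univ))) ^ (1 / p) := by gcongr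
      _ = ((ENNReal.ofReal (2 * (χ.rOut / χ.rIn) * (u * m))) ^ p * (Φ * H)) ^ (1 / p) := by
          have h5 : ENNReal.ofReal (2 * (χ.rOut / χ.rIn) * (u * m)) = ENNReal.ofReal u *
              (ENNReal.ofReal (2 * (χ.rOut / χ.rIn)) * ENNReal.ofReal m) := by
            rw [← ENNReal.ofReal_mul (by positivity), ← ENNReal.ofReal_mul hu0.le]
            ring_nf
          rw [hH, h5, ENNReal.mul_rpow_of_nonneg (ENNReal.ofReal u) _ hp0.le]
          congr 1
          ring
      _ = _ := by
          rw [ENNReal.mul_rpow_of_nonneg _ _ (by positivity), ← ENNReal.rpow_mul,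
            mul_one_div_cancel hp0.ne', ENNReal.rpow_one]
  have key : J ^ (1 / p) ≤ ENNReal.ofReal (|1 - u| + 2 * (χ.rOut / χ.rIn) * (u * m)) *
      (Φ * H) ^ (1 / p) := by
    rw [ENNReal.ofReal_add (by positivity) (by positivity), add_mul]
    exact hle.trans (add_le_add h₁.le h₂)
  have := ENNReal.rpow_le_rpow key hp0.le
  rwa [ENNReal.mul_rpow_of_nonneg _ _ hp0.le, ← ENNReal.rpow_mul, ← ENNReal.rpow_mul,
    one_div_mul_cancel hp0.ne', ENNReal.rpow_one, ENNReal.rpow_one,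
    ENNReal.ofReal_rpow_of_nonneg (by positivity) hp0.le] at this

end CutoffPower

/-! ### Optimality of the constant -/

section Optimality

open Filter Topology

/-- This gives a dominating function for the truncation error. With u = e^(-lτ): for τ ≥ 0, u l τ ≤
1 - u; for τ ≤ 0, l |τ| ≤ u - 1 handles u ≤ 2, and u ≤ 2(u - 1) handles u ≥ 2. -/
theorem exp_mul_min_le {l L : ℝ} (hl : 0 < l) (hL : 0 < L) (τ : ℝ) :
    Real.exp (-l * τ) * min 1 (L * |τ|) ≤ (2 + 2 * (L / l)) * |1 - Real.exp (-l * τ)| := by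
  set u := Real.exp (-l * τ) with hu
  have hu0 : 0 < u := Real.exp_pos _
  have hLl : 0 < L / l := by positivity
  rcases le_total 0 τ with h | h
  · have h1 : u ≤ 1 := Real.exp_le_one_iff.2 (by nlinarith)
    have h2 : u * (l * τ) ≤ 1 - u := by
      have h3 := Real.add_one_le_exp (l * τ)
      have h4 : u * Real.exp (l * τ) = 1 := by rw [hu, ← Real.exp_add]; simp
      nlinarith
    rw [abs_of_nonneg h, abs_of_nonneg (by linarith)]
    calc u * min 1 (L * τ) ≤ u * (L * τ) := by gcongr; exact min_le_right _ _
      _ = L / l * (u * (l * τ)) := by field_simp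
      _ ≤ L / l * (1 - u) := by gcongr
      _ ≤ _ := by nlinarith
  · have h1 : -l * τ ≤ u - 1 := by linarith [Real.add_one_le_exp (-l * τ)]
    have h0 : 0 ≤ -l * τ := by nlinarith
    rw [abs_of_nonpos h, abs_sub_comm, abs_of_nonneg (by linarith)]
    rcases le_total 2 u with h2 | h2
    · calc u * min 1 (L * -τ) ≤ u * 1 := by gcongr; exact min_le_left _ _
        _ ≤ _ := by nlinarith
    · calc u * min 1 (L * -τ) ≤ 2 * (L * -τ) :=
          mul_le_mul h2 (min_le_right _ _)
            (le_min zero_le_one (mul_nonneg hL.le (by linarith))) zero_le_two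
        _ = 2 * (L / l) * (-l * τ) := by field_simp
        _ ≤ 2 * (L / l) * (u - 1) := by gcongr
        _ ≤ _ := by nlinarith

variable {E : Type*} [NormedAddCommGroup E] [InnerProductSpace ℝ E] [MeasurableSpace E]
  [BorelSpace E] [FiniteDimensional ℝ E] [Nontrivial E]

theorem lintegral_cutoffPower_ne_zero (χ : ContDiffBump (0 : ℝ)) {p a l N : ℝ} (hp : 0 ≤ p)
    (hl : p * l = Module.finrank ℝ E - a) (hN : 0 < N) :
    ∫⁻ x : E, ENNReal.ofReal (‖x‖ ^ (-a)) * ‖cutoffPower χ l N x‖ₑ ^ p ≠ 0 := by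
  rw [lintegral_cutoffPower_eq χ hp hl]
  refine mul_ne_zero (lt_of_lt_of_le ?_ (le_lintegral_bump_rpow χ hN)).ne'
    (Measure.measure_univ_ne_zero.2 (Measure.toSphere_ne_zero _))
  have := χ.rIn_pos
  rw [ENNReal.ofReal_pos]
  positivity

theorem le_lintegral_of_forall_cutoffPower (χ : ContDiffBump (0 : ℝ)) {p a l L : ℝ} (hp : 1 ≤ p)
    (hl : p * l = Module.finrank ℝ E - a) (hl0 : 0 < l) (ha : 0 ≤ a) (hL : 0 < L)
    (hχL : ∀ s t : ℝ, |χ s - χ t| ≤ min 1 (L * |s - t|)) {η : E} (hη : ‖η‖ = 1) {C : ℝ≥0∞}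
    (hfin : ∀ N : ℝ, 0 < N →
      ∫⁻ x : E, ENNReal.ofReal (‖x‖ ^ (-a)) * ‖cutoffPower χ l N x‖ₑ ^ p ≠ ∞)
    (hC : ∀ N : ℝ, 0 < N →
      C * ∫⁻ x : E, ENNReal.ofReal (‖x‖ ^ (-a)) * ‖cutoffPower χ l N x‖ₑ ^ p ≤
      ∫⁻ z : E × E, ENNReal.ofReal (‖z.1 - z.2‖ ^ (-(Module.finrank ℝ E + a))) *
        ‖cutoffPower χ l N z.1 - cutoffPower χ l N z.2‖ₑ ^ p) :
    C ≤ ∫⁻ x : E, ENNReal.ofReal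
      (|1 - ‖x‖ ^ (-l)| ^ p * ‖x - η‖ ^ (-(Module.finrank ℝ E + a))) := by
  have hp0 : 0 < p := by linarith
  set s : ℝ := Module.finrank ℝ E + a with hs
  have hs0 : 0 ≤ s := by positivity
  rw [lintegral_one_sub_rpow_eq]
  set B := 2 * (χ.rOut / χ.rIn) with hB
  have hB0 : 0 < B := by have := χ.rIn_pos; have := χ.rOut_pos; positivity
  set w : ℝ → ℝ≥0∞ := fun τ => ENNReal.ofReal (Real.exp (Module.finrank ℝ E * τ)) with hw
  have hK := measurable_sphereKernel s η
  let G : ℕ → ℝ → ℝ≥0∞ := fun k τ => w τ * (ENNReal.ofReal ((|1 - Real.exp (-l * τ)| +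
    B * (Real.exp (-l * τ) * min 1 (L * (|τ| / (k + 1))))) ^ p) * sphereKernel s τ η)
  have hCG : ∀ k, C ≤ ∫⁻ τ, G k τ := by
    intro k
    have hN : (0 : ℝ) < k + 1 := by positivity
    -- The Hardy integral is nonzero and finite, so it can be cancelled. The scale is N = k + 1.
    refine (ENNReal.mul_le_mul_iff_left (lintegral_cutoffPower_ne_zero χ hp0.le hl hN)
      (hfin _ hN)).1 ((hC _ hN).trans ?_)
    have hcm : Measurable (cutoffPower χ l (k + 1) : E → ℝ) :=
      (contDiff_cutoffPower (k := 0) χ hl0.ne' hN).continuous.measurable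
    rw [lintegral_prod_eq_lintegral_pairMeasure (by fun_prop), ← lintegral_mul_const' _ _ (hfin _ hN)]
    refine lintegral_mono fun τ => ?_
    simp only [G, mul_assoc]
    gcongr
    rw [← mul_assoc]
    refine (lintegral_pairMeasure_cutoffPower_le χ hp hl hN
      (m := min 1 (L * (|τ| / (k + 1)))) (by positivity) (fun t => ?_) hη hl0.ne').trans_eq
      (by rw [mul_assoc, mul_assoc])
    refine (hχL _ _).trans_eq ?_
    rw [← sub_div, sub_add_cancel_left, abs_div, abs_neg, abs_of_pos hN]
  -- If the constant is infinite there is nothing to prove; otherwise its integrand, times a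
  -- constant, dominates every `G k`.
  by_cases hD : ∫⁻ τ, w τ * (ENNReal.ofReal (|1 - Real.exp (-l * τ)| ^ p) * sphereKernel s τ η) = ∞
  · rw [hD]; exact le_top
  refine ge_of_tendsto' (tendsto_lintegral_of_dominated_convergence (F := G)
    (fun τ => ENNReal.ofReal ((1 + B * (2 + 2 * (L / l))) ^ p) * (w τ *
      (ENNReal.ofReal (|1 - Real.exp (-l * τ)| ^ p) * sphereKernel s τ η)))
    (fun k => by fun_prop) (fun k => Eventually.of_forall fun τ => ?_) ?_ ?_) hCG
  · have h1 : min 1 (L * (|τ| / (k + 1))) ≤ min 1 (L * |τ|) := by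
      gcongr
      exact div_le_self (abs_nonneg _) (by simp)
    have h2 := exp_mul_min_le hl0 hL τ
    have h3 : |1 - Real.exp (-l * τ)| + B * (Real.exp (-l * τ) * min 1 (L * (|τ| / (k + 1)))) ≤
        (1 + B * (2 + 2 * (L / l))) * |1 - Real.exp (-l * τ)| := by
      have := mul_le_mul_of_nonneg_left
        ((mul_le_mul_of_nonneg_left h1 (Real.exp_nonneg (-l * τ))).trans h2) hB0.le
      linarith
    simp only [G]
    rw [mul_left_comm (ENNReal.ofReal ((1 + _) ^ p)),
      ← mul_assoc (ENNReal.ofReal (_ ^ p)) (ENNReal.ofReal (_ ^ p)) (sphereKernel _ _ _),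
      ← ENNReal.ofReal_mul (by positivity), ← Real.mul_rpow (by positivity) (abs_nonneg _)]
    gcongr
  · rw [lintegral_const_mul _ (by fun_prop)]
    exact ENNReal.mul_ne_top ENNReal.ofReal_ne_top hD
  -- Away from τ = 0 the kernel is finite, so the limit passes through the product.
  · have h0 : ∀ᵐ τ : ℝ, τ ≠ 0 := by simp [ae_iff]
    filter_upwards [h0] with τ hτ
    refine ENNReal.Tendsto.const_mul (ENNReal.Tendsto.mul_const (ENNReal.tendsto_ofReal ?_)
      (Or.inr (sphereKernel_lt_top hs0 hτ hη).ne)) (Or.inr ENNReal.ofReal_ne_top)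
    have h1 : Tendsto (fun k : ℕ => |τ| / ((k : ℝ) + 1)) atTop (𝓝 0) :=
      tendsto_const_nhds.div_atTop (tendsto_atTop_add_const_right _ _ tendsto_natCast_atTop_atTop)
    have h2 : Continuous fun x : ℝ => (|1 - Real.exp (-l * τ)| +
        B * (Real.exp (-l * τ) * min 1 (L * x))) ^ p :=
      Continuous.rpow_const (by fun_prop) fun _ => Or.inr hp0.le
    simpa [Function.comp_def] using (h2.tendsto 0).comp h1

end Optimality

/-! ### Translation to the stated integrals and conclusion -/

theorem besovEnergy_eq {n : ℕ} {𝕜 : Type*} [RCLike 𝕜] {p : ℝ} (hp : 0 ≤ p) (β : ℝ)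
    (f : EuclideanSpace ℝ (Fin n) → 𝕜) :
    besovEnergy p β f = ∫⁻ z : EuclideanSpace ℝ (Fin n) × EuclideanSpace ℝ (Fin n),
      ENNReal.ofReal (‖z.1 - z.2‖ ^
        (-(Module.finrank ℝ (EuclideanSpace ℝ (Fin n)) + p * β))) * ‖f z.1 - f z.2‖ₑ ^ p := by
  refine lintegral_congr fun z => ?_
  rw [finrank_euclideanSpace_fin, div_eq_inv_mul, ENNReal.ofReal_mul (by positivity),
    Real.rpow_neg (norm_nonneg _), ← ofReal_norm, ENNReal.ofReal_rpow_of_nonneg (norm_nonneg _) hp]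

theorem hardyIntegral_eq {n : ℕ} {𝕜 : Type*} [RCLike 𝕜] {p : ℝ} (hp : 0 ≤ p) (β : ℝ)
    (f : EuclideanSpace ℝ (Fin n) → 𝕜) :
    hardyIntegral p β f = ∫⁻ x : EuclideanSpace ℝ (Fin n),
      ENNReal.ofReal (‖x‖ ^ (-(p * β))) * ‖f x‖ₑ ^ p := by
  refine lintegral_congr fun x => ?_
  rw [ENNReal.ofReal_mul (by positivity), ← ofReal_norm,
    ENNReal.ofReal_rpow_of_nonneg (norm_nonneg _) hp]

theorem hardyConst_eq {n : ℕ} (p β : ℝ) (η : EuclideanSpace ℝ (Fin n)) :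
    hardyConst p β η = ∫⁻ x : EuclideanSpace ℝ (Fin n),
      ENNReal.ofReal (|1 - ‖x‖ ^ (-(((n : ℝ) - p * β) / p))| ^ p *
        ‖x - η‖ ^ (-(Module.finrank ℝ (EuclideanSpace ℝ (Fin n)) + p * β))) := by
  rw [hardyConst, finrank_euclideanSpace_fin]
  ring_nf

theorem lemma1 {𝕜 : Type*} [RCLike 𝕜] (n : ℕ) (p β : ℝ)
    (hβ0 : 0 < β) (hβ1 : β < 1) (hp1 : 1 ≤ p) (hpn : p < (n : ℝ) / β)
    (η : EuclideanSpace ℝ (Fin n)) (hη : ‖η‖ = 1) :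
    (∀ f : 𝓢(EuclideanSpace ℝ (Fin n), 𝕜),
        hardyConst p β η * hardyIntegral p β f ≤ besovEnergy p β f) ∧
      (∀ C : ℝ≥0∞,
        (∀ f : 𝓢(EuclideanSpace ℝ (Fin n), 𝕜),
          C * hardyIntegral p β f ≤ besovEnergy p β f) →
        C ≤ hardyConst p β η) := by
  have hp0 : 0 < p := by linarith
  have ha : 0 < p * β := by positivity
  have han : p * β < n := (lt_div_iff₀ hβ0).1 hpn
  have hfr : (Module.finrank ℝ (EuclideanSpace ℝ (Fin n)) : ℝ) = n := by simp
  -- The existence of a unit vector excludes n = 0.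
  have : Nontrivial (EuclideanSpace ℝ (Fin n)) := ⟨η, 0, by rintro rfl; simp at hη⟩
  have hl : p * (((n : ℝ) - p * β) / p) =
      Module.finrank ℝ (EuclideanSpace ℝ (Fin n)) - p * β := by
    rw [hfr]; field_simp
  have hl0 : 0 < ((n : ℝ) - p * β) / p := div_pos (by linarith) hp0
  borelize 𝕜
  refine ⟨fun f => ?_, fun C hC => ?_⟩
  · rw [hardyConst_eq, hardyIntegral_eq hp0.le, besovEnergy_eq hp0.le]
    exact mul_lintegral_le_lintegral_prod f.continuous.measurable hp1 hl ha.le hη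
      (f.lintegral_rpow_norm_mul_lt_top hp1 ha (hfr ▸ han)).ne
  · rw [hardyConst_eq]
    let χ : ContDiffBump (0 : ℝ) := ⟨1, 2, one_pos, one_lt_two⟩
    obtain ⟨L, hL, hχL⟩ := exists_abs_sub_le_min χ
    have henorm : ∀ r : ℝ, ‖(r : 𝕜)‖ₑ = ‖r‖ₑ := fun r => by
      rw [← ofReal_norm, ← ofReal_norm, RCLike.norm_ofReal, Real.norm_eq_abs]
    refine le_lintegral_of_forall_cutoffPower χ hp1 hl hl0 ha.le hL hχL hη (fun N hN => ?_)
      fun N hN => ?_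
    · have := ((cutoffPowerSchwartz (E := EuclideanSpace ℝ (Fin n)) 𝕜 χ hl0.ne'
        hN).lintegral_rpow_norm_mul_lt_top hp1 ha (hfr ▸ han)).ne
      simpa only [cutoffPowerSchwartz_apply, henorm] using this
    · have := hC (cutoffPowerSchwartz 𝕜 χ hl0.ne' hN)
      rw [hardyIntegral_eq hp0.le, besovEnergy_eq hp0.le] at this
      simpa only [cutoffPowerSchwartz_apply, ← RCLike.ofReal_sub, henorm] using this
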